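/- Let $(\Omega,\mathcal F,\mathbb P)$ be a probability space, $p^*,p\in\mathbb N$, let $\Upsilon\subseteq\mathbb R^{p^*}$, $\upsilon_0\in\Upsilon$, let $\mathcal D:\mathbb R^{p^*}\to\mathbb R^{p^*}$ be linear, and let $\omega,\nu_1,\mathtt g,\mathtt r^*>0$ and $\mathtt x\ge 0$. For $\mathtt r\ge 0$ put $$\Upsilon(\mathtt r)=\{\upsilon\in\Upsilon:\ \|\mathcal D(\upsilon-\upsilon_0)\|\le \mathtt r\},$$ with Euclidean norms throughout, and assume that every point of $\Upsilon(\mathtt r^*)$ is a limit of points $\upsilon\in\Upsilon$ with $\|\mathcal D(\upsilon-\upsilon_0)\|<\mathtt r^*$ (this is automatic if, e.g., $\Upsilon=\mathbb R^{p^*}$ or $\Upsilon$ is convex). Let $\breve{\mathcal Y}(\upsilon)$, $\upsilon\in\Upsilon$, be a random process with values in $\mathbb R^p$ and almost surely continuous paths such that $\breve{\mathcal Y}(\upsilon_0)=0$ almost surely. Suppose that for each $0<\mathtt r<\mathtt r^*$, all $\upsilon,\upsilon'\in\Upsilon(\mathtt r)$ and all $|\lambda|\le\mathtt g$, $$\sup_{\|u\|\le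 1}\log \mathbb E\exp\left\{\lambda\,\frac{u^\top\bigl(\breve{\mathcal Y}(\upsilon)-\breve{\mathcal Y}(\upsilon')\bigr)}{\omega\|\mathcal D(\upsilon-\upsilon')\|}\right\}\le\frac{\nu_1^2\lambda^2}{2},$$ where, if $\mathcal D(\upsilon-\upsilon')=0$, the condition is understood as $\breve{\mathcal Y}(\upsilon)=\breve{\mathcal Y}(\upsilon')$ almost surely. Put $\mathtt g_0=\nu_1\mathtt g$ and, for $Q\ge0$, $$\mathfrak z_Q(\mathtt x,Q)^2=\begin{cases}\bigl(1+\sqrt{\mathtt x+Q}\bigr)^2,&\text{if }1+\sqrt{\mathtt x+Q}\le\mathtt g_0,\\ 1+\bigl\{2\mathtt g_0^{-1}(\mathtt x+Q)+\mathtt g_0\bigr\}^2,&\text{otherwise.}\end{cases}$$ Then there is an event of probability at least $1-e^{-\mathtt x}$ on which $$\sup_{0\le\mathtt r\le\mathtt r^*}\ \sup_{\upsilon\in\Upsilon(\mathtt r)}\left\{\frac{1}{6\omega\nu_1}\|\breve{\mathcal Y}(\upsilon)\|-2\mathtt r^2\right\}\le\mathfrak z_Q(\mathtt x,2p^*+2p)^2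 .$$ -/

import Mathlib

open MeasureTheory ProbabilityTheory

noncomputable section

/-- The local set `Υ(r) = {υ ∈ Υ : ‖D (υ - υ₀)‖ ≤ r}`. -/
def localSet {q : ℕ} (Ups : Set (EuclideanSpace ℝ (Fin q)))
    (D : EuclideanSpace ℝ (Fin q) →ₗ[ℝ] EuclideanSpace ℝ (Fin q))
    (υ₀ : EuclideanSpace ℝ (Fin q)) (r : ℝ) : Set (EuclideanSpace ℝ (Fin q)) :=
  {υ | υ ∈ Ups ∧ ‖D (υ - υ₀)‖ ≤ r}

/-- The squared deviation constant `𝔷(x, Q)²` belonging to the threshold `g₀`. -/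
def zSq (g₀ x Q : ℝ) : ℝ :=
  if 1 + √(x + Q) ≤ g₀ then (1 + √(x + Q)) ^ 2
  else 1 + (2 * g₀⁻¹ * (x + Q) + g₀) ^ 2

/-- The sub-Gaussian condition on the increments of `Y` over a set `S`: for `υ, υ' ∈ S`,
`‖u‖ ≤ 1` and `|lam| ≤ g`,
`log E exp {lam * uᵀ (Y υ - Y υ') / (ω ‖D (υ - υ')‖)} ≤ ν₁² lam² / 2`,
where the expectation is required to be finite. The quotient has no meaning if `D (υ - υ') = 0`
(for an injective `D` only if `υ = υ'`); then the increment has to vanish almost surely. -/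
def IncrementCondition {Ω : Type*} [MeasurableSpace Ω] (P : Measure Ω) {q p : ℕ}
    (Y : EuclideanSpace ℝ (Fin q) → Ω → EuclideanSpace ℝ (Fin p))
    (D : EuclideanSpace ℝ (Fin q) →ₗ[ℝ] EuclideanSpace ℝ (Fin q))
    (ω ν₁ g : ℝ) (S : Set (EuclideanSpace ℝ (Fin q))) : Prop :=
  ∀ υ ∈ S, ∀ υ' ∈ S,
    (D (υ - υ') = 0 → ∀ᵐ s ∂P, Y υ s = Y υ' s) ∧
    (D (υ - υ') ≠ 0 → ∀ u : EuclideanSpace ℝ (Fin p), ‖u‖ ≤ 1 → ∀ lam : ℝ, |lam| ≤ g →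
      Integrable
        (fun s => Real.exp (lam * (inner ℝ u (Y υ s - Y υ' s) / (ω * ‖D (υ - υ')‖)))) P ∧
      Real.log (∫ s, Real.exp (lam * (inner ℝ u (Y υ s - Y υ' s) / (ω * ‖D (υ - υ')‖))) ∂P)
        ≤ ν₁ ^ 2 * lam ^ 2 / 2)

end

/-! The bound comes from chaining inside dyadic shells of the seminorm `‖D (υ - υ₀)‖`. Exponential
moments exist only for `|λ| ≤ g`, so every increment is controlled by Chernoff at one common
exponent `l ≤ ν₁ * g`: an increment of length at most `δ` exceeds `δ * (l / 2 + w / l)` with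
probability at most `exp (-w)`.

In a ball of radius `R`, volume bounds the net at scale `R / 2 ^ (k + 1)` by `(5 * 2 ^ k) ^ q`
points. The entropy grows linearly in `k` while the links shrink geometrically, so the chain costs
only a multiple of `R`; norms reduce to `5 ^ p` directions
(`HasIncrementTail.measureReal_exists_lt_inner_le`).

The shell of radius about `2 ^ j * z` gets failure probability `exp (-x) / 2 ^ (j + 1)`. Its bound
is the radius times a factor affine in `j`, which the quadratic penalty dominates
(`shell_le_penalty`). `exists_parameter_le_zSq` picks `l` and `z` to match the stated constant;
density and path continuity pass from countable to arbitrary index sets. -/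

/-! ### Volumetric nets -/

section SeparatedSets

open Metric Module

variable {T E : Type*} [NormedAddCommGroup E] [NormedSpace ℝ E] [FiniteDimensional ℝ E]

/-- Volume bound for the size of an `ε`-separated family in a ball of radius `R`. -/
theorem card_le_of_pairwise_le_norm_sub (f : T → E) {R ε : ℝ} (hR : 0 ≤ R) (hε : 0 < ε)
    (s : Finset T) (hs : ∀ t ∈ s, ‖f t‖ ≤ R)
    (hsep : ∀ t ∈ s, ∀ t' ∈ s, t ≠ t' → ε ≤ ‖f t - f t'‖) :
    (s.card : ℝ) ≤ (1 + 2 * R / ε) ^ finrank ℝ E := by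
  borelize E
  let μ : Measure E := Measure.addHaar
  have hδ : 0 < ε / 2 := by positivity
  have hρ : 0 < ε / 2 + R := by positivity
  have hdisj : Set.Pairwise (s : Set T) (Function.onFun Disjoint fun t => ball (f t) (ε / 2)) := by
    intro t ht t' ht' htt'
    apply ball_disjoint_ball
    rw [dist_eq_norm]
    linarith [hsep t ht t' ht' htt']
  have hsub : (⋃ t ∈ s, ball (f t) (ε / 2)) ⊆ ball (0 : E) (ε / 2 + R) := by
    refine Set.iUnion₂_subset fun t ht => ball_subset_ball' ?_
    rw [dist_zero_right]
    linarith [hs t ht]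
  have hvol : (s.card : ENNReal) * ENNReal.ofReal ((ε / 2) ^ finrank ℝ E) * μ (ball 0 1) ≤
      ENNReal.ofReal ((ε / 2 + R) ^ finrank ℝ E) * μ (ball 0 1) :=
    calc
      _ = μ (⋃ t ∈ s, ball (f t) (ε / 2)) := by
        rw [measure_biUnion_finset hdisj fun c _ => measurableSet_ball]
        simp only [μ.addHaar_ball_of_pos _ hδ, Finset.sum_const, nsmul_eq_mul, mul_assoc]
      _ ≤ μ (ball (0 : E) (ε / 2 + R)) := measure_mono hsub
      _ = _ := by simp only [μ.addHaar_ball_of_pos _ hρ]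
  have hcard : (s.card : ENNReal) * ENNReal.ofReal ((ε / 2) ^ finrank ℝ E) ≤
      ENNReal.ofReal ((ε / 2 + R) ^ finrank ℝ E) :=
    (ENNReal.mul_le_mul_iff_left (measure_ball_pos _ _ zero_lt_one).ne' measure_ball_lt_top.ne).1
      hvol
  have hreal := ENNReal.toReal_le_of_le_ofReal (by positivity) hcard
  rw [ENNReal.toReal_mul, ENNReal.toReal_natCast, ENNReal.toReal_ofReal (by positivity),
    ← le_div_iff₀ (by positivity), ← div_pow] at hreal
  have hratio : 1 + 2 * R / ε = (ε / 2 + R) / (ε / 2) := by field_simp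
  rwa [hratio]

/-- A family in a ball of radius `R` has an `ε`-net of its own points of controlled size. -/
theorem exists_finset_net (f : T → E) {R ε : ℝ} (hR : 0 ≤ R) (hε : 0 < ε)
    (S : Set T) (hS : ∀ t ∈ S, ‖f t‖ ≤ R) :
    ∃ N : Finset T, (∀ t ∈ N, t ∈ S) ∧ (∀ t ∈ S, ∃ t' ∈ N, ‖f t - f t'‖ ≤ ε) ∧
      (N.card : ℝ) ≤ (1 + 2 * R / ε) ^ finrank ℝ E := by
  classical
  let Sep : Finset T → Prop := fun N => (∀ t ∈ N, t ∈ S) ∧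
    ∀ t ∈ N, ∀ t' ∈ N, t ≠ t' → ε ≤ ‖f t - f t'‖
  let C : Set ℕ := {n | ∃ N : Finset T, Sep N ∧ N.card = n}
  have hbound : ∀ N, Sep N → (N.card : ℝ) ≤ (1 + 2 * R / ε) ^ finrank ℝ E := fun N hN =>
    card_le_of_pairwise_le_norm_sub f hR hε N (fun t ht => hS t (hN.1 t ht)) hN.2
  have hne : C.Nonempty := ⟨0, ∅, by simp [Sep], rfl⟩
  have hbdd : BddAbove C := by
    refine ⟨⌊(1 + 2 * R / ε) ^ finrank ℝ E⌋₊, ?_⟩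
    rintro n ⟨N, hN, rfl⟩
    exact Nat.le_floor (hbound N hN)
  -- A separated set of maximal cardinality is a net: a point far from it could be added.
  obtain ⟨N, hN, hmax⟩ := Nat.sSup_mem hne hbdd
  refine ⟨N, hN.1, ?_, hbound N hN⟩
  intro t ht
  by_contra! hfar
  have htN : t ∉ N := fun h => by
    have := hfar t h
    simp at this
    linarith
  have hins : Sep (insert t N) := by
    refine ⟨by simpa using ⟨ht, hN.1⟩, ?_⟩
    intro a ha b hb hab
    rcases Finset.mem_insert.1 ha with rfl | haN <;> rcases Finset.mem_insert.1 hb with rfl | hbN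
    · exact absurd rfl hab
    · exact (hfar b hbN).le
    · rw [norm_sub_rev]; exact (hfar a haN).le
    · exact hN.2 a haN b hbN hab
  have := le_csSup hbdd (show N.card + 1 ∈ C from ⟨_, hins, Finset.card_insert_of_notMem htN⟩)
  omega

/-- A finite subset of the unit ball that recovers the norm up to a factor `2`. -/
theorem exists_finset_norm_le_two_mul_inner {V : Type*} [NormedAddCommGroup V]
    [InnerProductSpace ℝ V] [FiniteDimensional ℝ V] :
    ∃ U : Finset V, (∀ u ∈ U, ‖u‖ ≤ 1) ∧ (U.card : ℝ) ≤ 5 ^ finrank ℝ V ∧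
      ∀ y : V, ∃ u ∈ U, ‖y‖ ≤ 2 * inner ℝ u y := by
  obtain ⟨U, hU, hnet, hcard⟩ := exists_finset_net (id : V → V) (R := 1) (ε := 1 / 2)
    zero_le_one (by norm_num) (closedBall 0 1) (by simp)
  refine ⟨U, by simpa using hU, by norm_num at hcard; exact hcard, fun y => ?_⟩
  have hunit : ‖(‖y‖⁻¹ • y)‖ ≤ 1 := by
    rw [norm_smul, norm_inv, norm_norm]
    exact inv_mul_le_one
  -- A point within `1 / 2` of `y / ‖y‖` loses at most `‖y‖ / 2` in the inner product. For `y = 0`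
  -- the convention `0⁻¹ = 0` keeps this valid.
  obtain ⟨u, hu, hclose⟩ := hnet (‖y‖⁻¹ • y) (by simpa using hunit)
  refine ⟨u, hu, ?_⟩
  have hinner : inner ℝ (‖y‖⁻¹ • y) y = ‖y‖ := by
    rw [real_inner_smul_left, real_inner_self_eq_norm_sq]
    rcases eq_or_ne ‖y‖ 0 with h | h
    · simp [h]
    · field_simp
  have hcs := real_inner_le_norm (‖y‖⁻¹ • y - u) y
  rw [inner_sub_left, hinner] at hcs
  have := mul_le_mul_of_nonneg_right hclose (norm_nonneg y)
  simp only [id] at this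
  linarith

end SeparatedSets

/-! ### Geometric sums -/

section Sums

theorem sum_range_inv_two_pow_succ_le (n : ℕ) :
    ∑ i ∈ Finset.range n, ((2 : ℝ) ^ (i + 1))⁻¹ ≤ 1 := by
  have h : ∑ i ∈ Finset.range n, ((2 : ℝ) ^ (i + 1))⁻¹ = 1 - ((2 : ℝ) ^ n)⁻¹ := by
    induction n with
    | zero => simp
    | succ n ih => rw [Finset.sum_range_succ, ih, pow_succ]; field_simp; ring
  rw [h]
  linarith [show (0 : ℝ) ≤ ((2 : ℝ) ^ n)⁻¹ by positivity]

theorem sum_range_affine_div_two_pow_le {a b : ℝ} (ha : 0 ≤ a) (hb : 0 ≤ b) (n : ℕ) :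
    ∑ i ∈ Finset.range n, (a + b * i) / 2 ^ i ≤ 2 * (a + b) := by
  have h : ∑ i ∈ Finset.range n, (a + b * i) / 2 ^ i
      = 2 * (a + b) - (2 * a + 2 * b * (n + 1)) / 2 ^ n := by
    induction n with
    | zero => simp; ring
    | succ n ih => rw [Finset.sum_range_succ, ih, pow_succ]; push_cast; field_simp; ring
  rw [h]
  linarith [show 0 ≤ (2 * a + 2 * b * (n + 1)) / 2 ^ n by positivity]

end Sums

/-! ### Chaining in a ball -/

section Chaining

open Module Real

variable {Ω : Type*} [MeasurableSpace Ω] {P : Measure Ω}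

/-- Chernoff bound for a variable with sub-Gaussian exponential moment at one point `l`. -/
theorem measureReal_lt_le_exp_neg [IsFiniteMeasure P] {X : Ω → ℝ} {d δ l w : ℝ} (hd : 0 < d)
    (hdδ : d ≤ δ) (hl : 0 < l) (hw : 0 ≤ w)
    (hint : Integrable (fun s => exp (l * (X s / d))) P)
    (hmgf : ∫ s, exp (l * (X s / d)) ∂P ≤ exp (l ^ 2 / 2)) :
    P.real {s | δ * (l / 2 + w / l) < X s} ≤ exp (-w) := by
  have hb : 0 ≤ l / 2 + w / l := by positivity
  calc P.real {s | δ * (l / 2 + w / l) < X s}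
      ≤ P.real {s | l / 2 + w / l ≤ X s / d} := by
        refine measureReal_mono fun s hs => ?_
        rw [Set.mem_ofPred_eq, le_div_iff₀ hd, mul_comm]
        exact (mul_le_mul_of_nonneg_right hdδ hb).trans hs.le
    _ ≤ exp (-l * (l / 2 + w / l)) * mgf (fun s => X s / d) P l :=
        measure_ge_le_exp_mul_mgf _ hl.le hint
    _ ≤ exp (-l * (l / 2 + w / l)) * exp (l ^ 2 / 2) := by gcongr; exact hmgf
    _ = exp (-w) := by
        rw [← exp_add]
        congr 1
        field_simp
        ring

variable {T E V : Type*} [NormedAddCommGroup E] [NormedAddCommGroup V] [InnerProductSpace ℝ V]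

/-- Increments of `Z` over `S` have deviations of the order of the distance of the images under
`f`, with exponential parameter `l`. -/
structure HasIncrementTail (P : Measure Ω) (Z : T → Ω → V) (f : T → E) (l : ℝ) (S : Set T) :
    Prop where
  ae_eq : ∀ t ∈ S, ∀ t' ∈ S, f t = f t' → ∀ᵐ s ∂P, Z t s = Z t' s
  tail : ∀ t ∈ S, ∀ t' ∈ S, ∀ u : V, ‖u‖ ≤ 1 → ∀ δ w : ℝ, 0 < δ → 0 ≤ w → ‖f t - f t'‖ ≤ δ →
    P.real {s | δ * (l / 2 + w / l) < inner ℝ u (Z t s - Z t' s)} ≤ exp (-w)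

theorem HasIncrementTail.mono {Z : T → Ω → V} {f : T → E} {l : ℝ} {S S' : Set T}
    (h : HasIncrementTail P Z f l S) (hS : S' ⊆ S) : HasIncrementTail P Z f l S' :=
  ⟨fun t ht t' ht' => h.ae_eq t (hS ht) t' (hS ht'),
    fun t ht t' ht' => h.tail t (hS ht) t' (hS ht')⟩

/-- This ends the chain at a finite level: finitely many distinct images have a positive minimal
distance. Only the images agree, as `f` need not be injective. -/
theorem exists_forall_norm_sub_le_imp_eq (f : T → E) (F : Finset T) (R : ℝ) :
    ∃ K : ℕ, ∀ t ∈ F, ∀ t' ∈ F, ‖f t - f t'‖ ≤ R / 2 ^ K → f t = f t' := by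
  have hlim : Filter.Tendsto (fun K : ℕ => R / (2 : ℝ) ^ K) Filter.atTop (nhds 0) :=
    tendsto_const_nhds.div_atTop (tendsto_pow_atTop_atTop_of_one_lt one_lt_two)
  have hev : ∀ᶠ K : ℕ in Filter.atTop, ∀ t ∈ F, ∀ t' ∈ F,
      ‖f t - f t'‖ ≤ R / 2 ^ K → f t = f t' := by
    rw [Filter.eventually_all_finset]
    intro t _
    rw [Filter.eventually_all_finset]
    intro t' _
    by_cases h : f t = f t'
    · exact Filter.Eventually.of_forall fun _ _ => h
    · filter_upwards [hlim.eventually (gt_mem_nhds (norm_pos_iff.2 (sub_ne_zero.2 h)))] with K hK hle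
      exact absurd hle (not_le.2 hK)
  exact hev.exists

variable [NormedSpace ℝ E] [FiniteDimensional ℝ E]

theorem exists_dyadic_nets (f : T → E) {R : ℝ} (hR : 0 < R) (F : Finset T) {t₀ : T} (ht₀ : t₀ ∈ F)
    (hft₀ : f t₀ = 0) (hF : ∀ t ∈ F, ‖f t‖ ≤ R) :
    ∃ N : ℕ → Finset T, N 0 = {t₀} ∧ (∀ k, N k ⊆ F) ∧
      (∀ k, ∀ t ∈ F, ∃ t' ∈ N k, ‖f t - f t'‖ ≤ R / 2 ^ k) ∧
      ∀ k, ((N (k + 1)).card : ℝ) ≤ (5 * 2 ^ k) ^ finrank ℝ E := by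
  have hnet : ∀ k : ℕ, ∃ N : Finset T, (∀ t ∈ N, t ∈ (F : Set T)) ∧
      (∀ t ∈ (F : Set T), ∃ t' ∈ N, ‖f t - f t'‖ ≤ R / 2 ^ (k + 1)) ∧
      (N.card : ℝ) ≤ (1 + 2 * R / (R / 2 ^ (k + 1))) ^ finrank ℝ E := fun k =>
    exists_finset_net f hR.le (by positivity) (F : Set T) hF
  choose N hNF hNnet hNcard using hnet
  refine ⟨fun k => Nat.casesOn k {t₀} N, rfl, ?_, ?_, ?_⟩
  · rintro (_ | k)
    · simpa using ht₀
    · exact hNF k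
  · rintro (_ | k) t ht
    · exact ⟨t₀, by simp, by simpa [hft₀] using hF t ht⟩
    · exact hNnet k t ht
  · intro k
    refine (hNcard k).trans (pow_le_pow_left₀ (by positivity) ?_ _)
    have h1 : (1 : ℝ) ≤ 2 ^ k := one_le_pow₀ one_le_two
    have h2 : 2 * R / (R / 2 ^ (k + 1)) = 4 * 2 ^ k := by
      rw [pow_succ]; field_simp; ring
    rw [h2]
    linarith

/-- Chaining bound over a finite family whose images lie in a ball of radius `R`. -/
theorem HasIncrementTail.measureReal_exists_lt_inner_le [IsProbabilityMeasure P]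
    {Z : T → Ω → V} {f : T → E} {l R y : ℝ} (hl : 0 < l) (hR : 0 < R) (hy : 0 ≤ y)
    {F : Finset T} (h : HasIncrementTail P Z f l (F : Set T)) {t₀ : T} (ht₀ : t₀ ∈ F)
    (hft₀ : f t₀ = 0) (hZt₀ : ∀ᵐ s ∂P, Z t₀ s = 0) (hF : ∀ t ∈ F, ‖f t‖ ≤ R)
    (U : Finset V) (hU : ∀ u ∈ U, ‖u‖ ≤ 1) {m : ℕ} (hUcard : (U.card : ℝ) ≤ 5 ^ m) :
    P.real {s | ∃ t ∈ F, ∃ u ∈ U,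
      2 * R * (l / 2 + (y + m * log 5 + finrank ℝ E * log 10 + 2 * log 2) / l) <
        inner ℝ u (Z t s)} ≤ exp (-y) := by
  obtain ⟨N, hN0, hNF, hNnet, hNcard⟩ := exists_dyadic_nets f hR F ht₀ hft₀ hF
  choose! pr hprN hprd using hNnet
  obtain ⟨K, hK⟩ := exists_forall_norm_sub_le_imp_eq f F R
  set q := finrank ℝ E with hq
  have hl2 : 0 ≤ log 2 := log_nonneg one_le_two
  have hl5 : 0 ≤ log 5 := log_nonneg (by norm_num)
  -- The logarithm of the number of links at level `i` is paid in full, and `(i + 1) * log 2` more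
  -- makes the levels summable to `exp (-y)`.
  let w : ℕ → ℝ := fun i => y + m * log 5 + q * (log 5 + i * log 2) + (i + 1) * log 2
  have hw : ∀ i, 0 ≤ w i := fun i => by positivity
  let link : ℕ → T → V → Set Ω := fun i t u =>
    {s | R / 2 ^ i * (l / 2 + w i / l) < inner ℝ u (Z t s - Z (pr i t) s)}
  let bad : Set Ω := ⋃ i ∈ Finset.range K, ⋃ t ∈ N (i + 1), ⋃ u ∈ U, link i t u
  have hlink : ∀ i, ∀ t ∈ N (i + 1), ∀ u ∈ U, P.real (link i t u) ≤ exp (-w i) := by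
    intro i t ht u hu
    have htF := hNF _ ht
    exact h.tail t htF (pr i t) (hNF _ (hprN i t htF)) u (hU u hu) _ _ (by positivity) (hw i)
      (hprd i t htF)
  have hbad : P.real bad ≤ exp (-y) := by
    have hlevel : ∀ i, P.real (⋃ t ∈ N (i + 1), ⋃ u ∈ U, link i t u) ≤
        exp (-y) * ((2 : ℝ) ^ (i + 1))⁻¹ := by
      intro i
      calc P.real (⋃ t ∈ N (i + 1), ⋃ u ∈ U, link i t u)
          ≤ ∑ t ∈ N (i + 1), P.real (⋃ u ∈ U, link i t u) := measureReal_biUnion_finset_le _ _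
        _ ≤ ∑ t ∈ N (i + 1), ∑ u ∈ U, P.real (link i t u) :=
            Finset.sum_le_sum fun t _ => measureReal_biUnion_finset_le _ _
        _ ≤ ∑ t ∈ N (i + 1), ∑ u ∈ U, exp (-w i) :=
            Finset.sum_le_sum fun t ht => Finset.sum_le_sum fun u hu => hlink i t ht u hu
        _ = (N (i + 1)).card * (U.card * exp (-w i)) := by simp
        _ ≤ (5 * 2 ^ i) ^ q * (5 ^ m * exp (-w i)) := by gcongr; exact hNcard i
        _ = exp (-y) * ((2 : ℝ) ^ (i + 1))⁻¹ := by
            have e5 : (5 : ℝ) = exp (log 5) := (exp_log (by norm_num)).symm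
            have e2 : (2 : ℝ) = exp (log 2) := (exp_log (by norm_num)).symm
            conv_lhs => rw [e5]
            conv_rhs => rw [e2]
            have e2i : (2 : ℝ) ^ i = exp (i * log 2) := by rw [exp_nat_mul, ← e2]
            rw [e2i, ← exp_add, ← exp_nat_mul, ← exp_nat_mul, ← exp_nat_mul, ← exp_neg,
              ← exp_add, ← exp_add, ← exp_add]
            congr 1
            simp only [w]
            push_cast
            ring
    calc P.real bad
        ≤ ∑ i ∈ Finset.range K, P.real (⋃ t ∈ N (i + 1), ⋃ u ∈ U, link i t u) :=
          measureReal_biUnion_finset_le _ _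
      _ ≤ ∑ i ∈ Finset.range K, exp (-y) * ((2 : ℝ) ^ (i + 1))⁻¹ :=
          Finset.sum_le_sum fun i _ => hlevel i
      _ = exp (-y) * ∑ i ∈ Finset.range K, ((2 : ℝ) ^ (i + 1))⁻¹ := by rw [Finset.mul_sum]
      _ ≤ exp (-y) * 1 := by gcongr; exact sum_range_inv_two_pow_succ_le K
      _ = exp (-y) := mul_one _
  -- Inclusion in `bad` holds only almost surely, since both ends of the chain are identified up to
  -- null sets.
  refine le_trans (ENNReal.toReal_mono (measure_ne_top P _) (measure_mono_ae ?_)) hbad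
  have hlast : ∀ᵐ s ∂P, ∀ t ∈ F, Z t s = Z (pr K t) s := by
    rw [Filter.eventually_all_finset]
    exact fun t ht => h.ae_eq t ht _ (hNF _ (hprN K t ht))
      (hK t ht _ (hNF _ (hprN K t ht)) (hprd K t ht))
  filter_upwards [hZt₀, hlast] with s hs0 hsK
  rintro ⟨t, ht, u, hu, hlt⟩
  by_contra hgood
  have hgood' : ∀ i < K, ∀ t ∈ N (i + 1),
      inner ℝ u (Z t s) ≤ inner ℝ u (Z (pr i t) s) + R / 2 ^ i * (l / 2 + w i / l) := by
    intro i hi t ht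
    by_contra! hc
    refine hgood ?_
    change s ∈ bad
    simp only [bad, Set.mem_iUnion]
    refine ⟨i, Finset.mem_range.2 hi, t, ht, u, hu, ?_⟩
    simp only [link, Set.mem_ofPred_eq, inner_sub_right]
    linarith
  have hchain : ∀ k ≤ K, ∀ t ∈ N k,
      inner ℝ u (Z t s) ≤ ∑ i ∈ Finset.range k, R / 2 ^ i * (l / 2 + w i / l) := by
    intro k
    induction k with
    | zero =>
      intro _ t ht
      rw [hN0, Finset.mem_singleton] at ht
      simp [ht, hs0]
    | succ k ih =>
      intro hk t ht
      rw [Finset.sum_range_succ]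
      have := ih (by omega) (pr k t) (hprN k t (hNF _ ht))
      linarith [hgood' k (by omega) t ht]
  have hfin := hchain K le_rfl (pr K t) (hprN K t ht)
  rw [← hsK t ht] at hfin
  refine absurd (hlt.trans_le hfin) (not_lt.2 ?_)
  have hsum := sum_range_affine_div_two_pow_le
    (a := l / 2 + (y + m * log 5 + q * log 5 + log 2) / l) (b := (q * log 2 + log 2) / l)
    (by positivity) (by positivity) K
  calc ∑ i ∈ Finset.range K, R / 2 ^ i * (l / 2 + w i / l)
      = R * ∑ i ∈ Finset.range K, (l / 2 + (y + m * log 5 + q * log 5 + log 2) / l +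
          (q * log 2 + log 2) / l * i) / 2 ^ i := by
        rw [Finset.mul_sum]
        refine Finset.sum_congr rfl fun i _ => ?_
        simp only [w]
        ring
    _ ≤ R * (2 * (l / 2 + (y + m * log 5 + q * log 5 + log 2) / l +
          (q * log 2 + log 2) / l)) := by gcongr
    _ = 2 * R * (l / 2 + (y + m * log 5 + q * log 10 + 2 * log 2) / l) := by
        rw [log_ten_eq]; ring

end Chaining

/-! ### Peeling into dyadic shells -/

section Peeling

open Module Real

variable {Ω : Type*} [MeasurableSpace Ω] {P : Measure Ω} {T E V : Type*}
  [NormedAddCommGroup E] [NormedSpace ℝ E] [FiniteDimensional ℝ E]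
  [NormedAddCommGroup V] [InnerProductSpace ℝ V] [FiniteDimensional ℝ V]

/-- On the `j`-th dyadic shell, of outer radius `ρ = (3 / 4) * 2 ^ j * z`, the quadratic penalty
exceeds `ρ * z` by a factor that grows with `j`. -/
theorem shell_le_penalty {z r : ℝ} (hz : 0 < z) (j : ℕ)
    (hr : j = 0 ∨ 3 / 4 * 2 ^ (j - 1) * z < r) :
    3 / 4 * 2 ^ j * z * ((7 + 0.35 * j) * z) ≤ 6 * (2 * r ^ 2 + z ^ 2) := by
  rcases j with _ | _ | j
  · norm_num
    nlinarith [sq_nonneg r, sq_nonneg z]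
  · have hr' : 3 / 4 * z < r := by simpa using hr
    norm_num
    nlinarith
  · have hr' : 3 / 4 * (2 * 2 ^ j) * z < r := by
      simpa [pow_succ, mul_comm, mul_left_comm] using hr
    have h2 : (j : ℝ) + 1 ≤ 2 ^ j := by exact_mod_cast Nat.lt_two_pow_self
    set a : ℝ := 2 ^ j
    have hj : (0 : ℝ) ≤ j := Nat.cast_nonneg j
    have hsq : (3 / 4 * (2 * a) * z) ^ 2 ≤ r ^ 2 := by gcongr
    have hpow : (2 : ℝ) ^ (j + 1 + 1) = 4 * a := by simp only [a]; ring
    rw [hpow]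
    push_cast
    have haz : 0 ≤ a * z ^ 2 := by positivity
    have hfac : 3 / 4 * 4 * (7 + 0.35 * ((j : ℝ) + 1 + 1)) ≤ 12 * (9 / 4) * a := by linarith
    have := mul_le_mul_of_nonneg_right hfac haz
    nlinarith [sq_nonneg z]

/-- Penalized maximal bound over a finite family, by peeling into dyadic shells. -/
theorem HasIncrementTail.measureReal_exists_penalty_lt_norm_le [IsProbabilityMeasure P]
    {Z : T → Ω → V} {f : T → E} {l x z : ℝ} (hl : 0 < l) (hx : 0 ≤ x) (hz : 0 < z)
    (hlz : ∀ j : ℕ, 4 * (l / 2 + (x + (j + 1) * log 2 + finrank ℝ V * log 5 +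
      finrank ℝ E * log 10 + 2 * log 2) / l) ≤ (7 + 0.35 * j) * z)
    {F : Finset T} (h : HasIncrementTail P Z f l (F : Set T)) {t₀ : T} (ht₀ : t₀ ∈ F)
    (hft₀ : f t₀ = 0) (hZt₀ : ∀ᵐ s ∂P, Z t₀ s = 0) :
    P.real {s | ∃ t ∈ F, 6 * (2 * ‖f t‖ ^ 2 + z ^ 2) < ‖Z t s‖} ≤ exp (-x) := by
  classical
  obtain ⟨U, hU, hUcard, hUnorm⟩ := exists_finset_norm_le_two_mul_inner (V := V)
  have hl2 : 0 ≤ log 2 := log_nonneg one_le_two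
  let ρ : ℕ → ℝ := fun j => 3 / 4 * 2 ^ j * z
  have hρ : ∀ j, 0 < ρ j := fun j => by positivity
  have hlarge : ∀ r : ℝ, ∃ j, r ≤ ρ j := by
    intro r
    obtain ⟨j, hj⟩ := pow_unbounded_of_one_lt (r / (3 / 4 * z)) one_lt_two
    refine ⟨j, ?_⟩
    rw [div_lt_iff₀ (by positivity)] at hj
    simp only [ρ]
    linarith
  -- Minimality of the level gives the lower bound on `‖f t‖` that the penalty comparison needs.
  let lev : T → ℕ := fun t => Nat.find (hlarge ‖f t‖)
  let y : ℕ → ℝ := fun j => x + (j + 1) * log 2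
  let shell : ℕ → Set Ω := fun j => {s | ∃ t ∈ F.filter (fun t => ‖f t‖ ≤ ρ j), ∃ u ∈ U,
    2 * ρ j * (l / 2 + (y j + finrank ℝ V * log 5 + finrank ℝ E * log 10 + 2 * log 2) / l) <
      inner ℝ u (Z t s)}
  have hshell : ∀ j, P.real (shell j) ≤ exp (-x) * ((2 : ℝ) ^ (j + 1))⁻¹ := by
    intro j
    have hyj : exp (-y j) = exp (-x) * ((2 : ℝ) ^ (j + 1))⁻¹ := by
      have e2 : ((2 : ℝ) ^ (j + 1))⁻¹ = exp (-(((j + 1 : ℕ) : ℝ) * log 2)) := by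
        rw [exp_neg, exp_nat_mul, exp_log two_pos]
      rw [e2, ← exp_add]
      simp only [y]
      push_cast
      congr 1
      ring
    rw [← hyj]
    refine (h.mono (S' := (F.filter (fun t => ‖f t‖ ≤ ρ j) : Finset T)) ?_
      ).measureReal_exists_lt_inner_le hl (hρ j) (by positivity) (t₀ := t₀) ?_ hft₀ hZt₀ ?_
        U hU hUcard
    · exact Finset.coe_subset.2 (Finset.filter_subset _ _)
    · simp [ht₀, hft₀, (hρ j).le]
    · exact fun t ht => (Finset.mem_filter.1 ht).2
  have hcover : {s | ∃ t ∈ F, 6 * (2 * ‖f t‖ ^ 2 + z ^ 2) < ‖Z t s‖} ⊆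
      ⋃ j ∈ Finset.range (F.sup lev + 1), shell j := by
    rintro s ⟨t, ht, hlt⟩
    simp only [Set.mem_iUnion]
    refine ⟨lev t, Finset.mem_range.2 (Nat.lt_succ_of_le (Finset.le_sup ht)), t,
      Finset.mem_filter.2 ⟨ht, Nat.find_spec (hlarge ‖f t‖)⟩, ?_⟩
    obtain ⟨u, hu, hle⟩ := hUnorm (Z t s)
    refine ⟨u, hu, ?_⟩
    have hpen := shell_le_penalty (r := ‖f t‖) hz (lev t) (by
      rcases Nat.eq_zero_or_pos (lev t) with h0 | h0
      · exact Or.inl h0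
      · exact Or.inr (not_le.1 (Nat.find_min (hlarge ‖f t‖) (Nat.sub_lt h0 one_pos))))
    -- The `4` in `hlz` is `2` from the chaining sum times `2` from the finite set of directions.
    have := mul_le_mul_of_nonneg_left (hlz (lev t)) (hρ (lev t)).le
    simp only [ρ, y] at this ⊢
    linarith
  calc _ ≤ P.real (⋃ j ∈ Finset.range (F.sup lev + 1), shell j) :=
        measureReal_mono hcover (measure_ne_top P _)
    _ ≤ ∑ j ∈ Finset.range (F.sup lev + 1), P.real (shell j) := measureReal_biUnion_finset_le _ _
    _ ≤ ∑ j ∈ Finset.range (F.sup lev + 1), exp (-x) * ((2 : ℝ) ^ (j + 1))⁻¹ :=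
        Finset.sum_le_sum fun j _ => hshell j
    _ = exp (-x) * ∑ j ∈ Finset.range (F.sup lev + 1), ((2 : ℝ) ^ (j + 1))⁻¹ := by
        rw [Finset.mul_sum]
    _ ≤ exp (-x) * 1 := by gcongr; exact sum_range_inv_two_pow_succ_le _
    _ = exp (-x) := mul_one _

/-- Penalized maximal bound over a countable family. -/
theorem HasIncrementTail.measure_exists_penalty_lt_norm_le [IsProbabilityMeasure P]
    {Z : T → Ω → V} {f : T → E} {l x z : ℝ} (hl : 0 < l) (hx : 0 ≤ x) (hz : 0 < z)
    (hlz : ∀ j : ℕ, 4 * (l / 2 + (x + (j + 1) * log 2 + finrank ℝ V * log 5 +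
      finrank ℝ E * log 10 + 2 * log 2) / l) ≤ (7 + 0.35 * j) * z)
    {S C : Set T} (h : HasIncrementTail P Z f l S) {t₀ : T} (ht₀ : t₀ ∈ S)
    (hft₀ : f t₀ = 0) (hZt₀ : ∀ᵐ s ∂P, Z t₀ s = 0) (hC : C.Countable) (hCS : C ⊆ S) :
    P {s | ∃ t ∈ C, 6 * (2 * ‖f t‖ ^ 2 + z ^ 2) < ‖Z t s‖} ≤ ENNReal.ofReal (exp (-x)) := by
  classical
  have : Countable C := hC.to_subtype
  let bad : Finset C → Set Ω := fun F =>
    {s | ∃ t ∈ F, 6 * (2 * ‖f t‖ ^ 2 + z ^ 2) < ‖Z t s‖}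
  have hunion : {s | ∃ t ∈ C, 6 * (2 * ‖f t‖ ^ 2 + z ^ 2) < ‖Z t s‖} = ⋃ F, bad F := by
    ext s
    simp only [Set.mem_iUnion]
    constructor
    · rintro ⟨t, ht, hlt⟩
      exact ⟨{⟨t, ht⟩}, ⟨t, ht⟩, by simp, hlt⟩
    · rintro ⟨F, t, -, hlt⟩
      exact ⟨t, t.2, hlt⟩
  have hmono : Monotone bad := fun F G hFG s ⟨t, ht, hlt⟩ => ⟨t, hFG ht, hlt⟩
  -- Continuity from below: the bound does not depend on the finite subfamily, so it survives the
  -- union.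
  rw [hunion, hmono.directed_le.measure_iUnion]
  refine iSup_le fun F => ?_
  -- Chaining needs its root in the family, and `t₀` may lie outside `C`.
  have hF : ((insert t₀ (F.image Subtype.val) : Finset T) : Set T) ⊆ S := by
    intro t ht
    simp only [Finset.coe_insert, Finset.coe_image, Set.mem_insert_iff, Set.mem_image] at ht
    rcases ht with rfl | ⟨c, -, rfl⟩
    · exact ht₀
    · exact hCS c.2
  have hfin := (h.mono hF).measureReal_exists_penalty_lt_norm_le hl hx hz hlz
    (Finset.mem_insert_self _ _) hft₀ hZt₀
  rw [ENNReal.le_ofReal_iff_toReal_le (measure_ne_top _ _) (exp_nonneg _)]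
  refine le_trans (measureReal_mono ?_) hfin
  rintro s ⟨t, ht, hlt⟩
  exact ⟨t, Finset.mem_insert_of_mem (Finset.mem_image_of_mem _ ht), hlt⟩

end Peeling

/-! ### Numerical calibration -/

section Calibration

open Real

theorem zSq_nonneg (g₀ x Q : ℝ) : 0 ≤ zSq g₀ x Q := by
  unfold zSq
  split_ifs <;> positivity

/-- A choice of the exponential parameter for which the chaining bound is dominated by `zSq`. -/
theorem exists_parameter_le_zSq {g₀ x : ℝ} (hg₀ : 0 < g₀) (hx : 0 ≤ x) {q p : ℕ} (hq : 0 < q)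
    (hp : 0 < p) :
    ∃ l z : ℝ, 0 < l ∧ l ≤ g₀ ∧ 0 < z ∧ z ^ 2 ≤ zSq g₀ x (2 * (q : ℝ) + 2 * (p : ℝ)) ∧
      ∀ j : ℕ, 4 * (l / 2 + (x + (j + 1) * log 2 + p * log 5 + q * log 10 + 2 * log 2) / l) ≤
        (7 + 0.35 * j) * z := by
  have hq1 : (1 : ℝ) ≤ q := by exact_mod_cast hq
  have hp1 : (1 : ℝ) ≤ p := by exact_mod_cast hp
  obtain ⟨B, hB⟩ : ∃ B : ℝ, B = x + (2 * (q : ℝ) + 2 * (p : ℝ)) := ⟨_, rfl⟩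
  have hB4 : 4 ≤ B := by linarith
  -- Here `1.152` is just above `log 10 / 2`, matching the weight `2 * q` in `B`, and `2.08` is just
  -- above `3 * log 2`.
  have hnum : ∀ j : ℕ, x + (j + 1) * log 2 + p * log 5 + q * log 10 + 2 * log 2 ≤
      1.152 * B + 2.08 + 0.6932 * j := by
    intro j
    have hj : (0 : ℝ) ≤ j := Nat.cast_nonneg j
    have h2 := log_two_lt_d9
    have h5 := log_five_lt_d9
    rw [log_ten_eq]
    have a1 : (j : ℝ) * log 2 ≤ j * 0.6932 := by gcongr; linarith
    have a2 : (p : ℝ) * log 5 ≤ p * 1.61 := by gcongr; linarith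
    have a3 : (q : ℝ) * (log 2 + log 5) ≤ q * 2.303 := by gcongr; linarith
    linarith
  unfold zSq
  rw [← hB]
  split_ifs with hcase
  · set b := √B with hb
    have hbB : b ^ 2 = B := sq_sqrt (by linarith)
    have hb2 : 2 ≤ b := le_sqrt_of_sq_le (by linarith)
    -- `l / 2 + B / l` is smallest for `l` of order `√B`; the case assumption makes `1 + √B`
    -- admissible.
    refine ⟨1 + b, 1 + b, by linarith, hcase, by linarith, le_rfl, fun j => ?_⟩
    have hj : (0 : ℝ) ≤ j := Nat.cast_nonneg j
    have hdiv : (x + (j + 1) * log 2 + p * log 5 + q * log 10 + 2 * log 2) / (1 + b) ≤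
        (1.2 + 0.08 * j) * (1 + b) := by
      rw [div_le_iff₀ (by linarith)]
      refine (hnum j).trans ?_
      nlinarith [mul_nonneg hj (by nlinarith : (0 : ℝ) ≤ (1 + b) * (1 + b) - 9)]
    nlinarith [mul_nonneg hj (by linarith : (0 : ℝ) ≤ 1 + b)]
  · have hpos : 0 < 2 * g₀⁻¹ * B + g₀ := by positivity
    -- Otherwise the largest admissible exponent is used.
    refine ⟨g₀, 2 * g₀⁻¹ * B + g₀, hg₀, le_rfl, hpos, by linarith, fun j => ?_⟩
    have hj : (0 : ℝ) ≤ j := Nat.cast_nonneg j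
    have hdiv : (x + (j + 1) * log 2 + p * log 5 + q * log 10 + 2 * log 2) / g₀ ≤
        (1.7 + 0.175 * j) * (g₀⁻¹ * B) := by
      rw [div_le_iff₀ hg₀, mul_assoc, mul_right_comm, inv_mul_cancel₀ hg₀.ne', one_mul]
      refine (hnum j).trans ?_
      nlinarith
    have hgB : 0 ≤ g₀⁻¹ * B := by positivity
    nlinarith [mul_nonneg hj hgB, mul_nonneg hj hg₀.le]

end Calibration

/-! ### From exponential moments to tails -/

section Increments

open Real

variable {Ω : Type*} [MeasurableSpace Ω] {P : Measure Ω} {q p : ℕ}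
  {Y : EuclideanSpace ℝ (Fin q) → Ω → EuclideanSpace ℝ (Fin p)}
  {D : EuclideanSpace ℝ (Fin q) →ₗ[ℝ] EuclideanSpace ℝ (Fin q)}

theorem IncrementCondition.hasIncrementTail [IsProbabilityMeasure P]
    {ω ν₁ g l : ℝ} (hω : 0 < ω) (hν₁ : 0 < ν₁) (hl : 0 < l) (hlg : l ≤ ν₁ * g)
    {S : Set (EuclideanSpace ℝ (Fin q))} (υ₀ : EuclideanSpace ℝ (Fin q))
    (h : ∀ υ ∈ S, ∀ υ' ∈ S, IncrementCondition P Y D ω ν₁ g {υ, υ'}) :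
    HasIncrementTail P (fun υ s => (ω * ν₁)⁻¹ • Y υ s) (fun υ => D (υ - υ₀)) l S := by
  have hsub : ∀ υ υ', D (υ - υ₀) - D (υ' - υ₀) = D (υ - υ') := fun υ υ' => by
    rw [← map_sub, sub_sub_sub_cancel_right]
  have hae : ∀ υ ∈ S, ∀ υ' ∈ S, D (υ - υ') = 0 → ∀ᵐ s ∂P, Y υ s = Y υ' s :=
    fun υ hυ υ' hυ' => (h υ hυ υ' hυ' υ (by simp) υ' (by simp)).1
  refine ⟨fun υ hυ υ' hυ' heq => ?_, fun υ hυ υ' hυ' u hu δ w hδ hw hdist => ?_⟩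
  · filter_upwards [hae υ hυ υ' hυ' (by rw [← hsub, heq, sub_self])] with s hs
    simp only [hs]
  · rw [hsub] at hdist
    by_cases hD : D (υ - υ') = 0
    · have hnull : P {s | δ * (l / 2 + w / l) <
          inner ℝ u ((ω * ν₁)⁻¹ • Y υ s - (ω * ν₁)⁻¹ • Y υ' s)} = 0 := by
        rw [measure_eq_zero_iff_ae_notMem]
        filter_upwards [hae υ hυ υ' hυ' hD] with s hs
        have : 0 ≤ δ * (l / 2 + w / l) := by positivity
        simpa [hs] using this
      rw [measureReal_def, hnull]
      exact exp_nonneg _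
    · have hd : 0 < ‖D (υ - υ')‖ := norm_pos_iff.2 hD
      -- Taking `λ = l / ν₁` normalises the variance factor to one, which is why the threshold is
      -- `ν₁ * g`.
      obtain ⟨hint, hlog⟩ := (h υ hυ υ' hυ' υ (by simp) υ' (by simp)).2 hD u hu (l / ν₁)
        (by rw [abs_of_pos (by positivity), div_le_iff₀ hν₁]; linarith)
      have hscale : (fun s => exp (l / ν₁ * (inner ℝ u (Y υ s - Y υ' s) /
          (ω * ‖D (υ - υ')‖)))) = fun s => exp (l *
          (inner ℝ u ((ω * ν₁)⁻¹ • Y υ s - (ω * ν₁)⁻¹ • Y υ' s) / ‖D (υ - υ')‖)) := by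
        funext s
        rw [← smul_sub, real_inner_smul_right]
        congr 1
        field_simp
      rw [hscale] at hint hlog
      refine measureReal_lt_le_exp_neg hd hdist hl hw hint ((le_exp_log _).trans (exp_le_exp.2 ?_))
      refine hlog.trans_eq ?_
      field_simp

end Increments

/-! ### Conclusion by density and continuity -/

theorem mainTheorem6 {Ω : Type*} [MeasurableSpace Ω] (P : Measure Ω) [IsProbabilityMeasure P]
    (pstar p : ℕ) (Ups : Set (EuclideanSpace ℝ (Fin pstar)))
    (D : EuclideanSpace ℝ (Fin pstar) →ₗ[ℝ] EuclideanSpace ℝ (Fin pstar))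
    (υ₀ : EuclideanSpace ℝ (Fin pstar)) (hυ₀ : υ₀ ∈ Ups)
    (Y : EuclideanSpace ℝ (Fin pstar) → Ω → EuclideanSpace ℝ (Fin p))
    (hYmeas : ∀ υ ∈ Ups, AEMeasurable (Y υ) P)
    (hYcont : ∀ᵐ s ∂P, ContinuousOn (fun υ => Y υ s) Ups)
    (hY₀ : ∀ᵐ s ∂P, Y υ₀ s = 0)
    (ω ν₁ g rstar : ℝ) (hω : 0 < ω) (hν₁ : 0 < ν₁) (hg : 0 < g) (hrstar : 0 < rstar)
    (hUps : localSet Ups D υ₀ rstar ⊆ closure {υ ∈ Ups | ‖D (υ - υ₀)‖ < rstar})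
    (hinc : ∀ r : ℝ, 0 < r → r < rstar →
      IncrementCondition P Y D ω ν₁ g (localSet Ups D υ₀ r))
    (x : ℝ) (hx : 0 ≤ x) :
    ∃ A : Set Ω, MeasurableSet A ∧ 1 - Real.exp (-x) ≤ P.real A ∧
      ∀ s ∈ A, ∀ r : ℝ, 0 ≤ r → r ≤ rstar → ∀ υ ∈ localSet Ups D υ₀ r,
        1 / (6 * ω * ν₁) * ‖Y υ s‖ - 2 * r ^ 2
          ≤ zSq (ν₁ * g) x (2 * (pstar : ℝ) + 2 * (p : ℝ)) := by
  -- For fixed `υ` the smallest admissible `r` is the worst. `N` need not be measurable; its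
  -- measurable hull is removed instead.
  suffices hbad : ∃ N : Set Ω, P N ≤ ENNReal.ofReal (Real.exp (-x)) ∧
      ∀ s ∉ N, ∀ υ ∈ localSet Ups D υ₀ rstar, 1 / (6 * ω * ν₁) * ‖Y υ s‖ ≤
        2 * ‖D (υ - υ₀)‖ ^ 2 + zSq (ν₁ * g) x (2 * (pstar : ℝ) + 2 * (p : ℝ)) by
    obtain ⟨N, hN, hbound⟩ := hbad
    refine ⟨(toMeasurable P N)ᶜ, (measurableSet_toMeasurable P N).compl, ?_, ?_⟩
    · rw [probReal_compl_eq_one_sub (measurableSet_toMeasurable P N), measureReal_def,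
        measure_toMeasurable]
      linarith [ENNReal.toReal_le_of_le_ofReal (Real.exp_nonneg _) hN]
    · intro s hs r _ hrr υ hυ
      have hsq : ‖D (υ - υ₀)‖ ^ 2 ≤ r ^ 2 := pow_le_pow_left₀ (norm_nonneg _) hυ.2 2
      linarith [hbound s (fun h => hs (subset_toMeasurable P N h)) υ ⟨hυ.1, hυ.2.trans hrr⟩]
  have hnonneg := zSq_nonneg (ν₁ * g) x (2 * (pstar : ℝ) + 2 * (p : ℝ))
  -- Zero dimensions are trivial and treated apart, because the calibration uses `B ≥ 4`.
  rcases Nat.eq_zero_or_pos p with rfl | hp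
  · refine ⟨∅, by simp, fun s _ υ _ => ?_⟩
    rw [Subsingleton.elim (Y υ s) 0, norm_zero, mul_zero]
    positivity
  rcases Nat.eq_zero_or_pos pstar with rfl | hq
  · refine ⟨{s | ¬ Y υ₀ s = 0}, by rw [ae_iff.1 hY₀]; exact zero_le, fun s hs υ _ => ?_⟩
    rw [Subsingleton.elim υ υ₀, not_not.1 hs, norm_zero, mul_zero]
    positivity
  obtain ⟨l, z, hl, hlg, hz, hzle, hlz⟩ :=
    exists_parameter_le_zSq (mul_pos hν₁ hg) hx hq hp
  set S : Set (EuclideanSpace ℝ (Fin pstar)) := {υ ∈ Ups | ‖D (υ - υ₀)‖ < rstar} with hS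
  have hυ₀S : υ₀ ∈ S := ⟨hυ₀, by simpa using hrstar⟩
  -- The radius `r < rstar` depends on the pair; no single one need serve all of `S`, hence the
  -- pairwise form.
  have hpair : ∀ υ ∈ S, ∀ υ' ∈ S, IncrementCondition P Y D ω ν₁ g {υ, υ'} := by
    intro υ hυ υ' hυ'
    obtain ⟨r, hr, hrr⟩ := exists_between
      (max_lt hrstar (max_lt hυ.2 hυ'.2))
    rw [max_lt_iff, max_lt_iff] at hr
    have hmem : ∀ a ∈ ({υ, υ'} : Set (EuclideanSpace ℝ (Fin pstar))),
        a ∈ localSet Ups D υ₀ r := by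
      rintro a (rfl | rfl)
      · exact ⟨hυ.1, hr.2.1.le⟩
      · exact ⟨hυ'.1, hr.2.2.le⟩
    exact fun a ha b hb => hinc r hr.1 hrr a (hmem a ha) b (hmem b hb)
  have htail := IncrementCondition.hasIncrementTail hω hν₁ hl hlg υ₀ hpair
  obtain ⟨C, hCS, hC, hSC⟩ :=
    (TopologicalSpace.IsSeparable.of_separableSpace S).exists_countable_dense_subset
  have hmain := htail.measure_exists_penalty_lt_norm_le hl hx hz (by simpa using hlz) hυ₀S
    (by simp) (by filter_upwards [hY₀] with s hs; simp [hs]) hC hCS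
  refine ⟨{s | ∃ υ ∈ C, 6 * (2 * ‖D (υ - υ₀)‖ ^ 2 + z ^ 2) < ‖(ω * ν₁)⁻¹ • Y υ s‖} ∪
    {s | ¬ ContinuousOn (fun υ => Y υ s) Ups}, ?_, ?_⟩
  · refine (measure_union_le _ _).trans ?_
    rw [ae_iff.1 hYcont, add_zero]
    exact hmain
  · intro s hs υ hυ
    rw [Set.mem_union, not_or] at hs
    have hcont : ContinuousOn (fun υ => Y υ s) Ups := not_not.1 hs.2
    have hCU : C ⊆ Ups := fun υ hυ => (hCS hυ).1
    have hDcont : Continuous fun υ => D (υ - υ₀) :=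
      D.continuous_of_finiteDimensional.comp (continuous_id.sub continuous_const)
    -- `hUps` puts boundary points in the closure of `S`, hence of `C`, and both sides are
    -- continuous along `C`.
    refine ContinuousWithinAt.closure_le (f := fun υ => 1 / (6 * ω * ν₁) * ‖Y υ s‖)
      (g := fun υ => 2 * ‖D (υ - υ₀)‖ ^ 2 + zSq (ν₁ * g) x (2 * (pstar : ℝ) + 2 * (p : ℝ)))
      (closure_minimal hSC isClosed_closure (hUps hυ))
      (((hcont υ hυ.1).mono hCU).norm.const_mul _)
      (Continuous.continuousWithinAt (by fun_prop)) fun a ha => ?_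
    have hle : ‖(ω * ν₁)⁻¹ • Y a s‖ ≤ 6 * (2 * ‖D (a - υ₀)‖ ^ 2 + z ^ 2) := by
      by_contra! hlt
      exact hs.1 ⟨a, ha, hlt⟩
    rw [norm_smul, Real.norm_of_nonneg (by positivity)] at hle
    have hfac : 1 / (6 * ω * ν₁) * ‖Y a s‖ = (ω * ν₁)⁻¹ * ‖Y a s‖ / 6 := by field_simp
    rw [hfac]
    linarith
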